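/- For $\tau\in\mathfrak H=\{\tau\in\mathbb C:\operatorname{Im}\tau>0\}$ and $z\in\mathbb C$ put $q=e^{2\pi i\tau}$, $y=e^{2\pi i z}$, $q^{1/2}=e^{\pi i\tau}$, $y^{\pm1/2}=e^{\pm\pi i z}$, and let $$\phi_{-2,1}(\tau,z)^{\frac12}\Delta(\tau)^{\frac12}:=(y^{\frac12}-y^{-\frac12})\,q^{\frac12}\prod_{n=1}^{\infty}(1-q^n)^{10}(1-q^ny)(1-q^ny^{-1}).$$ Let $a,b,c,d\in\mathbb Z$ with $ad-bc=1$ and $c>0$. Then there is exactly one $\epsilon(a,b,c,d)\in\mathbb C$ such that $$\phi_{-2,1}\Big(\frac{a\tau+b}{c\tau+d},\frac{z}{c\tau+d}\Big)^{\frac12}\Delta\Big(\frac{a\tau+b}{c\tau+d}\Big)^{\frac12}=\epsilon(a,b,c,d)\,(c\tau+d)^5\,e^{\frac{\pi i c z^2}{c\tau+d}}\,\phi_{-2,1}(\tau,z)^{\frac12}\Delta(\tau)^{\frac12}\qquad\text{for all }(\tau,z)\in\mathfrak H\times\mathbb C.$$ It satisfies $\epsilon(a,b,c,d)^2=1$,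 and $$\epsilon(a,b,c,d)=-e^{\pi i\left(\frac{a+d}{c}+12\,s(-d,c)\right)},\qquad\text{where}\quad s(h,k)=\sum_{r=1}^{k-1}\frac rk\Big(\frac{hr}{k}-\Big\lfloor\frac{hr}{k}\Big\rfloor-\frac12\Big)$$ is the Dedekind sum. -/

import Mathlib

noncomputable section

/-- The function `φ_{-2,1}^{1/2} Δ^{1/2}` of `(τ, z)`, given by the product
`(y^{1/2} - y^{-1/2}) q^{1/2} ∏_{n ≥ 1} (1 - q^n)^{10} (1 - q^n y) (1 - q^n y^{-1})`
with `q = e^{2πiτ}`, `y = e^{2πiz}`, `q^{1/2} = e^{πiτ}`, `y^{1/2} = e^{πiz}`.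
It is meaningful for `0 < im τ`; the index `n : ℕ` below stands for `n + 1`. -/
def sqrtPhiDelta (τ z : ℂ) : ℂ :=
  (Complex.exp (Real.pi * Complex.I * z) - Complex.exp (-(Real.pi * Complex.I * z))) *
    Complex.exp (Real.pi * Complex.I * τ) *
    ∏' n : ℕ,
      ((1 - Complex.exp (2 * Real.pi * Complex.I * τ) ^ (n + 1)) ^ 10 *
        (1 - Complex.exp (2 * Real.pi * Complex.I * τ) ^ (n + 1) *
          Complex.exp (2 * Real.pi * Complex.I * z)) *
        (1 - Complex.exp (2 * Real.pi * Complex.I * τ) ^ (n + 1) *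
          (Complex.exp (2 * Real.pi * Complex.I * z))⁻¹))

/-- The number `e` is a multiplier of `φ_{-2,1}^{1/2} Δ^{1/2}` for the matrix `(a, b; c, d)`:
the transformation law of weight `5` and index `1/2` holds with factor `e`
for all `(τ, z)` in the upper half plane times `ℂ`. -/
def TransformsWithSign (a b c d : ℤ) (e : ℂ) : Prop :=
  ∀ (τ : UpperHalfPlane) (z : ℂ),
    sqrtPhiDelta (((a : ℂ) * τ + b) / ((c : ℂ) * τ + d)) (z / ((c : ℂ) * τ + d)) =
      e * ((c : ℂ) * τ + d) ^ 5 *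
        Complex.exp (Real.pi * Complex.I * c * z ^ 2 / ((c : ℂ) * τ + d)) *
        sqrtPhiDelta τ z

/-- The Dedekind sum `s(h, k) = ∑_{r=1}^{k-1} (r/k) (hr/k - ⌊hr/k⌋ - 1/2)`, for `k > 0`. -/
def dedekindSum (h k : ℤ) : ℝ :=
  ∑ r ∈ Finset.Ico (1 : ℤ) k,
    ((r : ℝ) / k) * ((h : ℝ) * r / k - (⌊(h : ℝ) * r / k⌋ : ℝ) - 1 / 2)

end

/-! Write `F` for `sqrtPhiDelta`; the matrices `T` and `S` generate SL₂(ℤ), and each contributes the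
sign `-1`. For `T` this is read off from `q^{1/2}`. For `S`, fix `τ`: up to the exponential factor,
`F(-1/τ, z/τ)` has in `z` the quasi-periods of `F(τ, z)`. The derivatives at `0` are compared
through `η¹²`, so `F(-1/τ, z/τ)`, corrected by that factor, plus `τ⁵ F(τ, z)` vanishes doubly at
`0`. Its quotient by `F(τ, z)` is entire and doubly periodic, hence constant, hence zero
(`sqrtPhiDelta_neg_one_div`).

The multiplier is therefore the character with `S, T ↦ -1`, which is the sign on SL₂(𝔽₂) ≅ S₃
(`hasModTwoMultiplier_of_det`). Elementary congruences show that `(a + d)/c + 12 s(-d, c)` is an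
integer whose parity gives the same sign (`exists_int_eq_rademacher`). -/

/-! ### Euler products and entire doubly periodic functions -/

/-- The infinite product `∏_{n ≥ 1} (1 - q^n x)`. -/
noncomputable def eulerProd (q x : ℂ) : ℂ := ∏' n : ℕ, (1 - q ^ (n + 1) * x)

theorem summable_norm_pow_succ_mul {q : ℂ} (hq : ‖q‖ < 1) (x : ℂ) :
    Summable fun n : ℕ ↦ ‖-(q ^ (n + 1) * x)‖ := by
  simpa using ((summable_nat_add_iff 1).mpr
    (summable_geometric_of_lt_one (norm_nonneg q) hq)).mul_right ‖x‖

theorem multipliable_eulerProd {q : ℂ} (hq : ‖q‖ < 1) (x : ℂ) :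
    Multipliable fun n : ℕ ↦ 1 - q ^ (n + 1) * x := by
  simpa [sub_eq_add_neg] using multipliable_one_add_of_summable (summable_norm_pow_succ_mul hq x)

theorem eulerProd_ne_zero {q x : ℂ} (hq : ‖q‖ < 1) (h : ∀ n : ℕ, q ^ (n + 1) * x ≠ 1) :
    eulerProd q x ≠ 0 := by
  have := tprod_one_add_ne_zero_of_summable (f := fun n : ℕ ↦ -(q ^ (n + 1) * x))
    (fun n h0 ↦ h n (by linear_combination -h0)) (summable_norm_pow_succ_mul hq x)
  simpa [eulerProd, sub_eq_add_neg] using this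

theorem eulerProd_eq_mul {q : ℂ} (hq : ‖q‖ < 1) (x : ℂ) :
    eulerProd q x = (1 - q * x) * eulerProd q (q * x) := by
  unfold eulerProd
  rw [tprod_eq_zero_mul']
  · simp only [zero_add, pow_one]
    congr 2
    ext n
    ring
  · convert multipliable_eulerProd hq (q * x) using 2
    ring

theorem differentiable_eulerProd {q : ℂ} (hq : ‖q‖ < 1) : Differentiable ℂ (eulerProd q) := by
  intro x₀
  have hopen : IsOpen (Metric.ball (0 : ℂ) (‖x₀‖ + 1)) := Metric.isOpen_ball
  have hsum : Summable fun n : ℕ ↦ ‖q‖ ^ (n + 1) * (‖x₀‖ + 1) :=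
    ((summable_nat_add_iff 1).mpr
      (summable_geometric_of_lt_one (norm_nonneg q) hq)).mul_right _
  have key := hsum.hasProdLocallyUniformlyOn_nat_one_add
    (f := fun n x ↦ -(q ^ (n + 1) * x)) hopen
    (.of_forall fun n x hx ↦ by
      simp only [norm_neg, norm_mul, norm_pow]
      gcongr
      simpa using (mem_ball_zero_iff.mp hx).le)
    (fun n ↦ by fun_prop)
  have hd := key.differentiableOn (.of_forall fun _ ↦ by
    simpa [Finset.prod_fn] using
      DifferentiableOn.finsetProd (fun _ _ ↦ by fun_prop)) hopen
  have := hd.differentiableAt (hopen.mem_nhds (by simp : x₀ ∈ _))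
  simpa [eulerProd, sub_eq_add_neg] using! this

/-- An entire function with periods `1` and `τ`, where `τ` is not real, is constant. -/
theorem apply_eq_apply_of_doubly_periodic {f : ℂ → ℂ} (hf : Differentiable ℂ f) {τ : ℂ}
    (hτ : 0 < τ.im) (h1 : Function.Periodic f 1) (h2 : Function.Periodic f τ) (z w : ℂ) :
    f z = f w := by
  apply hf.apply_eq_apply_of_bounded
  have hK : IsCompact (Set.Icc (0 : ℝ) 1 ×ˢ Set.Icc (0 : ℝ) 1) := isCompact_Icc.prod isCompact_Icc
  have hb := (hK.image (f := fun p : ℝ × ℝ ↦ f (p.1 + p.2 * τ)) (by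
    have := hf.continuous; fun_prop)).isBounded
  refine hb.subset ?_
  rintro _ ⟨u, rfl⟩
  set t : ℝ := u.im / τ.im
  set s : ℝ := (u - t * τ).re
  have hu : u = s + t * τ := by
    apply Complex.ext
    · simp [s]
    · simp [t, hτ.ne']
  refine ⟨(Int.fract s, Int.fract t), ⟨⟨Int.fract_nonneg _, (Int.fract_lt_one _).le⟩,
    ⟨Int.fract_nonneg _, (Int.fract_lt_one _).le⟩⟩, ?_⟩
  have e : u = (((Int.fract s : ℝ) : ℂ) + ((Int.fract t : ℝ) : ℂ) * τ + ⌊s⌋ * 1) + ⌊t⌋ * τ := by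
    conv_lhs => rw [hu, ← Int.fract_add_floor s, ← Int.fract_add_floor t]
    push_cast
    ring
  rw [e, h2.int_mul, h1.int_mul]

/-- If `D` vanishes to second order at `0` and `F` has a simple zero there, then `D / F` is
differentiable at `0`, with the convention that its value is `0`. -/
theorem differentiableAt_div_of_double_zero {D F : ℂ → ℂ} (hD : Differentiable ℂ D)
    (hF : Differentiable ℂ F) (hD0 : D 0 = 0) (hF0 : F 0 = 0) (hD' : deriv D 0 = 0)
    (hF' : deriv F 0 ≠ 0) : DifferentiableAt ℂ (fun z ↦ D z / F z) 0 := by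
  have aux : ∀ {f : ℂ → ℂ}, Differentiable ℂ f → DifferentiableAt ℂ (dslope f 0) 0 := by
    intro f hf
    have := (Complex.differentiableOn_dslope (f := f) (c := 0) (s := Set.univ)
      Filter.univ_mem).2 hf.differentiableOn
    exact this.differentiableAt Filter.univ_mem
  -- At `z = 0` the left side is `0 / 0 = 0` and the right side is `D'(0) / F'(0) = 0`.
  have h : (fun z ↦ D z / F z) = fun z ↦ dslope D 0 z / dslope F 0 z := by
    ext z
    rcases eq_or_ne z 0 with rfl | hz
    · simp [hD0, hD']
    · rw [dslope_of_ne _ hz, dslope_of_ne _ hz, slope_def_field, slope_def_field, hD0, hF0]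
      field_simp
      simp
  rw [h]
  exact (aux hD).div (aux hF) (by simpa using hF')

/-! ### Quasi-periods, zeros and derivative of `sqrtPhiDelta` in `z` -/

open Complex in
theorem norm_cexp_two_pi_I_mul_lt_one {τ : ℂ} (hτ : 0 < τ.im) : ‖cexp (2 * Real.pi * I * τ)‖ < 1 :=
  UpperHalfPlane.norm_exp_two_pi_I_lt_one ⟨τ, hτ⟩

open Complex in
theorem sqrtPhiDelta_eq_eulerProd {τ : ℂ} (hτ : 0 < τ.im) (z : ℂ) :
    sqrtPhiDelta τ z = (cexp (Real.pi * I * z) - cexp (-(Real.pi * I * z))) *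
      cexp (Real.pi * I * τ) * (eulerProd (cexp (2 * Real.pi * I * τ)) 1 ^ 10 *
        eulerProd (cexp (2 * Real.pi * I * τ)) (cexp (2 * Real.pi * I * z)) *
        eulerProd (cexp (2 * Real.pi * I * τ)) (cexp (-(2 * Real.pi * I * z)))) := by
  have hq := norm_cexp_two_pi_I_mul_lt_one hτ
  have h1 := multipliable_eulerProd hq 1
  have h2 := multipliable_eulerProd hq (cexp (2 * Real.pi * I * z))
  have h3 := multipliable_eulerProd hq (cexp (-(2 * Real.pi * I * z)))
  unfold sqrtPhiDelta eulerProd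
  rw [← h1.tprod_pow, ← (h1.pow 10).tprod_mul h2, ← ((h1.pow 10).mul h2).tprod_mul h3]
  simp only [mul_one, Complex.exp_neg]

open Complex in
theorem differentiable_sqrtPhiDelta {τ : ℂ} (hτ : 0 < τ.im) :
    Differentiable ℂ (sqrtPhiDelta τ) := by
  have h := differentiable_eulerProd (norm_cexp_two_pi_I_mul_lt_one hτ)
  rw [funext (sqrtPhiDelta_eq_eulerProd hτ)]
  fun_prop

open Complex in
theorem cexp_pi_I_mul_add_one (z : ℂ) :
    cexp (Real.pi * I * (z + 1)) = -cexp (Real.pi * I * z) := by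
  rw [mul_add, mul_one, Complex.exp_add, exp_pi_mul_I]
  ring

open Complex in
theorem cexp_two_pi_I_mul_add_one (z : ℂ) :
    cexp (2 * Real.pi * I * (z + 1)) = cexp (2 * Real.pi * I * z) := by
  rw [mul_add, mul_one, Complex.exp_add, exp_two_pi_mul_I, mul_one]

open Complex in
theorem sqrtPhiDelta_add_one {τ : ℂ} (hτ : 0 < τ.im) (z : ℂ) :
    sqrtPhiDelta τ (z + 1) = -sqrtPhiDelta τ z := by
  rw [sqrtPhiDelta_eq_eulerProd hτ, sqrtPhiDelta_eq_eulerProd hτ]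
  simp only [Complex.exp_neg, cexp_pi_I_mul_add_one, cexp_two_pi_I_mul_add_one, inv_neg]
  ring

open Complex in
theorem sqrtPhiDelta_add_one_left (τ z : ℂ) :
    sqrtPhiDelta (τ + 1) z = -sqrtPhiDelta τ z := by
  unfold sqrtPhiDelta
  simp only [cexp_pi_I_mul_add_one, cexp_two_pi_I_mul_add_one]
  ring

-- The shift replaces `y` by `qy`, which moves the two Euler products by one factor in opposite
-- directions; the boundary factors recombine with `y^{1/2} - y^{-1/2}`.
open Complex in
theorem sqrtPhiDelta_add_period {τ : ℂ} (hτ : 0 < τ.im) (z : ℂ) :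
    sqrtPhiDelta τ (z + τ) =
      -cexp (-(Real.pi * I * τ) - 2 * Real.pi * I * z) * sqrtPhiDelta τ z := by
  have hq := norm_cexp_two_pi_I_mul_lt_one hτ
  rw [sqrtPhiDelta_eq_eulerProd hτ, sqrtPhiDelta_eq_eulerProd hτ]
  set u := cexp (Real.pi * I * τ) with hu
  set v := cexp (Real.pi * I * z) with hv
  have hu0 : u ≠ 0 := Complex.exp_ne_zero _
  have hv0 : v ≠ 0 := Complex.exp_ne_zero _
  have e1 : cexp (2 * Real.pi * I * τ) = u ^ 2 := by
    rw [hu, ← Complex.exp_nat_mul]; congr 1; push_cast; ring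
  have e2 : cexp (2 * Real.pi * I * z) = v ^ 2 := by
    rw [hv, ← Complex.exp_nat_mul]; congr 1; push_cast; ring
  simp only [mul_add, neg_add, Complex.exp_add, Complex.exp_sub, Complex.exp_neg, e1, e2,
    ← hu, ← hv] at hq ⊢
  have h1 := eulerProd_eq_mul hq (v ^ 2)
  have h2 := eulerProd_eq_mul hq ((v ^ 2)⁻¹ * (u ^ 2)⁻¹)
  rw [show u ^ 2 * ((v ^ 2)⁻¹ * (u ^ 2)⁻¹) = (v ^ 2)⁻¹ by field_simp] at h2
  rw [h2, h1, mul_comm (v ^ 2) (u ^ 2)]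
  field_simp
  ring

open Complex in
theorem sqrtPhiDelta_eq_zero {τ : ℂ} (hτ : 0 < τ.im) {z : ℂ} (h : sqrtPhiDelta τ z = 0) :
    ∃ m n : ℤ, z = m + n * τ := by
  have hq := norm_cexp_two_pi_I_mul_lt_one hτ
  rw [sqrtPhiDelta_eq_eulerProd hτ] at h
  have hexp : ∀ n : ℕ, ∀ w : ℂ, cexp (2 * Real.pi * I * τ) ^ (n + 1) * cexp w = 1 →
      ∃ m : ℤ, w = 2 * Real.pi * I * (m - (n + 1) * τ) := by
    intro n w hw
    rw [← Complex.exp_nat_mul, ← Complex.exp_add, Complex.exp_eq_one_iff] at hw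
    obtain ⟨m, hm⟩ := hw
    refine ⟨m, ?_⟩
    push_cast at hm
    linear_combination hm
  have hpi : (2 * Real.pi * I : ℂ) ≠ 0 := two_pi_I_ne_zero
  have hone : eulerProd (cexp (2 * Real.pi * I * τ)) 1 ≠ 0 := by
    refine eulerProd_ne_zero hq fun n hn ↦ ?_
    obtain ⟨m, hm⟩ := hexp n 0 (by simpa using hn)
    have h0 : (m : ℂ) - (n + 1) * τ = 0 := by
      rcases mul_eq_zero.mp hm.symm with h | h
      · exact absurd h hpi
      · exact h
    have := congrArg Complex.im h0
    simp at this
    rcases this with h | h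
    · have : (0 : ℝ) < n + 1 := by positivity
      exact absurd h this.ne'
    · exact hτ.ne' h
  simp only [mul_eq_zero, pow_eq_zero_iff, ne_eq, OfNat.ofNat_ne_zero, not_false_eq_true, hone,
    Complex.exp_ne_zero, or_false, false_or] at h
  rcases h with h | h | h
  · rw [sub_eq_zero, Complex.exp_eq_exp_iff_exists_int] at h
    obtain ⟨m, hm⟩ := h
    refine ⟨m, 0, mul_left_cancel₀ hpi ?_⟩
    push_cast
    linear_combination hm
  · by_contra hne
    refine eulerProd_ne_zero hq (fun n hn ↦ hne ?_) h
    obtain ⟨m, hm⟩ := hexp n _ hn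
    refine ⟨m, -(n + 1 : ℕ), mul_left_cancel₀ hpi ?_⟩
    push_cast
    linear_combination hm
  · by_contra hne
    refine eulerProd_ne_zero hq (fun n hn ↦ hne ?_) h
    obtain ⟨m, hm⟩ := hexp n _ hn
    refine ⟨-m, (n + 1 : ℕ), mul_left_cancel₀ hpi ?_⟩
    push_cast
    linear_combination -hm

open Complex in
theorem eta_pow_twelve (τ : ℂ) : ModularForm.eta τ ^ 12 =
    cexp (Real.pi * I * τ) * eulerProd (cexp (2 * Real.pi * I * τ)) 1 ^ 12 := by
  simp only [ModularForm.eta, eulerProd, ModularForm.eta_q_eq_pow, mul_pow, mul_one]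
  congr 1
  rw [Function.Periodic.qParam, ← Complex.exp_nat_mul]
  congr 1
  push_cast
  ring

theorem sqrtPhiDelta_zero (τ : ℂ) : sqrtPhiDelta τ 0 = 0 := by
  simp [sqrtPhiDelta]

-- The factor `y^{1/2} - y^{-1/2}` has a simple zero, and at `y = 1` the Euler products merge into a
-- 12th power.
open Complex in
theorem hasDerivAt_sqrtPhiDelta_zero {τ : ℂ} (hτ : 0 < τ.im) :
    HasDerivAt (sqrtPhiDelta τ) (2 * Real.pi * I * ModularForm.eta τ ^ 12) 0 := by
  have h := differentiable_eulerProd (norm_cexp_two_pi_I_mul_lt_one hτ)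
  rw [funext (sqrtPhiDelta_eq_eulerProd hτ), eta_pow_twelve]
  have hlin : HasDerivAt (fun z : ℂ ↦ Real.pi * I * z) (Real.pi * I) 0 := by
    simpa using (hasDerivAt_id (0 : ℂ)).const_mul (Real.pi * I : ℂ)
  have h1 : HasDerivAt (fun z : ℂ ↦ cexp (Real.pi * I * z) - cexp (-(Real.pi * I * z)))
      (2 * Real.pi * I) 0 := by
    refine (hlin.cexp.sub hlin.fun_neg.cexp).congr_deriv ?_
    simp
    ring
  have h2 : Differentiable ℂ fun z : ℂ ↦ eulerProd (cexp (2 * Real.pi * I * τ)) 1 ^ 10 *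
        eulerProd (cexp (2 * Real.pi * I * τ)) (cexp (2 * Real.pi * I * z)) *
        eulerProd (cexp (2 * Real.pi * I * τ)) (cexp (-(2 * Real.pi * I * z))) := by
    fun_prop
  refine ((h1.mul_const (cexp (Real.pi * I * τ))).mul (h2 0).hasDerivAt).congr_deriv ?_
  simp
  ring

/-! ### The transformation under `τ ↦ -1/τ` -/

open Complex in
theorem im_neg_one_div_pos {τ : ℂ} (hτ : 0 < τ.im) : 0 < (-1 / τ).im := by
  have := UpperHalfPlane.im_inv_neg_coe_pos ⟨τ, hτ⟩
  simpa [neg_div, inv_neg] using this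

open Complex in
theorem eta_neg_one_div_pow_twelve {τ : ℂ} (hτ : 0 < τ.im) :
    ModularForm.eta (-1 / τ) ^ 12 = -τ ^ 6 * ModularForm.eta τ ^ 12 := by
  have h := ModularForm.eta_comp_eq_csqrt_I_inv (show τ ∈ UpperHalfPlane.upperHalfPlaneSet from hτ)
  have hs : ∀ w : ℂ, w ≠ 0 → sqrt w ^ 12 = w ^ 6 := by
    intro w hw
    rw [sqrt_eq_exp hw, ← Complex.exp_nat_mul]
    rw [show ((12 : ℕ) : ℂ) * (log w / 2) = (6 : ℕ) * log w by push_cast; ring,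
      Complex.exp_nat_mul, Complex.exp_log hw]
  have hτ0 : τ ≠ 0 := by rintro rfl; simp at hτ
  simp only [Function.comp_apply, Pi.smul_apply, Pi.mul_apply, smul_eq_mul] at h
  rw [h, mul_pow, mul_pow, inv_pow, hs _ hτ0, hs _ I_ne_zero]
  have : I ^ 6 = -1 := by rw [show 6 = 4 + 2 from rfl, pow_add, I_pow_four, I_sq]; ring
  rw [this]
  ring

open Complex in
/-- An entire function with the quasi-periods of `sqrtPhiDelta τ` that vanishes to second order at
`0` is zero. -/
theorem eq_zero_of_quasiperiodic {τ : ℂ} (hτ : 0 < τ.im) {D : ℂ → ℂ} (hD : Differentiable ℂ D)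
    (h1 : ∀ z, D (z + 1) = -D z)
    (h2 : ∀ z, D (z + τ) = -cexp (-(Real.pi * I * τ) - 2 * Real.pi * I * z) * D z)
    (h0 : D 0 = 0) (h0' : deriv D 0 = 0) (z : ℂ) : D z = 0 := by
  set F := sqrtPhiDelta τ with hFdef
  have hF : Differentiable ℂ F := differentiable_sqrtPhiDelta hτ
  have hF' : deriv F 0 ≠ 0 := by
    rw [(hasDerivAt_sqrtPhiDelta_zero hτ).deriv]
    exact mul_ne_zero two_pi_I_ne_zero (pow_ne_zero _ (ModularForm.eta_ne_zero hτ))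
  have p1 : Function.Periodic (fun z ↦ D z / F z) 1 := by
    intro z
    simp only [h1, hFdef, sqrtPhiDelta_add_one hτ, neg_div_neg_eq]
  have p2 : Function.Periodic (fun z ↦ D z / F z) τ := by
    intro z
    simp only [h2, hFdef, sqrtPhiDelta_add_period hτ]
    exact mul_div_mul_left _ _ (neg_ne_zero.mpr (Complex.exp_ne_zero _))
  have hd0 := differentiableAt_div_of_double_zero hD hF h0 (sqrtPhiDelta_zero τ) h0' hF'
  have hdiff : Differentiable ℂ fun z ↦ D z / F z := by
    intro z
    by_cases hz : F z = 0
    · obtain ⟨m, n, rfl⟩ := sqrtPhiDelta_eq_zero hτ hz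
      -- Periodicity moves any lattice point to `0`.
      have e : (fun z ↦ D z / F z) = fun z ↦ (fun z ↦ D z / F z) (z - (m + n * τ)) := by
        ext w
        conv_lhs => rw [show w = (w - (m + n * τ)) + m * 1 + n * τ by ring]
        have a := p2.int_mul n ((w - (m + n * τ)) + m * 1)
        have b := p1.int_mul m (w - (m + n * τ))
        exact a.trans b
      rw [e]
      refine DifferentiableAt.comp (g := fun z ↦ D z / F z) _ ?_ (by fun_prop)
      simpa using hd0
    · exact (hD z).div (hF z) hz
  -- The constant is the value at `0`, which is `0 / 0 = 0`.
  have hconst : ∀ z, D z / F z = 0 := by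
    intro z
    have := apply_eq_apply_of_doubly_periodic hdiff hτ p1 p2 z 0
    simpa [h0] using this
  have hoff : ∀ z, F z ≠ 0 → D z = 0 := fun z hz ↦ by
    simpa [hz] using hconst z
  -- Zeros of `F` are isolated, so `D` vanishes near `z` off `z`, and by continuity at `z`.
  have hzero : ∀ᶠ w in nhdsWithin z {z}ᶜ, D w = 0 := by
    have : ∀ᶠ w in nhdsWithin z {z}ᶜ, F w ≠ 0 := by
      rcases (hF.analyticAt z).eventually_eq_zero_or_eventually_ne_zero with h | h
      · exfalso
        have hall : F = 0 := by
          have hA : AnalyticOnNhd ℂ F Set.univ := fun w _ ↦ hF.analyticAt w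
          exact hA.eq_of_eventuallyEq (fun _ _ ↦ analyticAt_const) h
        rw [hall] at hF'
        simp at hF'
      · exact h
    exact this.mono hoff
  have hc := hD.continuous.continuousAt (x := z)
  exact tendsto_nhds_unique (hc.tendsto.mono_left nhdsWithin_le_nhds)
    (tendsto_const_nhds.congr' (hzero.mono fun _ h ↦ h.symm))

open Complex in
theorem sqrtPhiDelta_neg_one_div {τ : ℂ} (hτ : 0 < τ.im) (z : ℂ) :
    sqrtPhiDelta (-1 / τ) (z / τ) =
      -τ ^ 5 * cexp (Real.pi * I * z ^ 2 / τ) * sqrtPhiDelta τ z := by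
  have hτ' := im_neg_one_div_pos hτ
  have hτ0 : τ ≠ 0 := by rintro rfl; simp at hτ
  have hF' := differentiable_sqrtPhiDelta hτ'
  have hF := differentiable_sqrtPhiDelta hτ
  set G : ℂ → ℂ := fun z ↦ cexp (-(Real.pi * I * z ^ 2 / τ)) * sqrtPhiDelta (-1 / τ) (z / τ)
    with hG
  have hGd : Differentiable ℂ G := by
    have : Differentiable ℂ fun z : ℂ ↦ sqrtPhiDelta (-1 / τ) (z / τ) :=
      hF'.comp (differentiable_id.div_const τ)
    exact Differentiable.mul (by fun_prop) this
  -- Division by `τ` exchanges the periods: the shift by `1` is minus the period `-1/τ`, the shift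
  -- by `τ` is the period `1`.
  have hG1 : ∀ z, G (z + 1) = -G z := by
    intro z
    have h := sqrtPhiDelta_add_period hτ' ((z + 1) / τ)
    rw [show (z + 1) / τ + -1 / τ = z / τ by ring] at h
    simp only [hG]
    rw [h, neg_mul, mul_neg, neg_neg, ← mul_assoc, ← Complex.exp_add]
    congr 2
    field_simp
    ring
  have hG2 : ∀ z, G (z + τ) = -cexp (-(Real.pi * I * τ) - 2 * Real.pi * I * z) * G z := by
    intro z
    simp only [hG]
    rw [show (z + τ) / τ = z / τ + 1 by field_simp, sqrtPhiDelta_add_one hτ', neg_mul, mul_neg,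
      ← mul_assoc, ← Complex.exp_add]
    congr 3
    field_simp
    ring
  have hG' : HasDerivAt G (-τ ^ 5 * (2 * Real.pi * I * ModularForm.eta τ ^ 12)) 0 := by
    have a : HasDerivAt (fun z : ℂ ↦ sqrtPhiDelta (-1 / τ) (z / τ))
        (2 * Real.pi * I * ModularForm.eta (-1 / τ) ^ 12 * (1 / τ)) 0 :=
      HasDerivAt.comp (h₂ := sqrtPhiDelta (-1 / τ)) 0
        (by simpa using hasDerivAt_sqrtPhiDelta_zero hτ') ((hasDerivAt_id 0).div_const τ)
    have b : DifferentiableAt ℂ (fun z : ℂ ↦ cexp (-(Real.pi * I * z ^ 2 / τ))) 0 := by fun_prop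
    refine (b.hasDerivAt.mul a).congr_deriv ?_
    rw [eta_neg_one_div_pow_twelve hτ]
    simp [sqrtPhiDelta_zero]
    field_simp
  have key := eq_zero_of_quasiperiodic hτ (D := fun z ↦ G z + τ ^ 5 * sqrtPhiDelta τ z)
    (by fun_prop) (fun z ↦ by simp only [hG1, sqrtPhiDelta_add_one hτ]; ring)
    (fun z ↦ by simp only [hG2, sqrtPhiDelta_add_period hτ]; ring)
    (by simp [hG, sqrtPhiDelta_zero])
    (by
      rw [(hG'.fun_add ((hasDerivAt_sqrtPhiDelta_zero hτ).const_mul (τ ^ 5))).deriv]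
      ring) z
  have hz : cexp (-(Real.pi * I * z ^ 2 / τ)) * sqrtPhiDelta (-1 / τ) (z / τ) =
      -(τ ^ 5 * sqrtPhiDelta τ z) := eq_neg_of_add_eq_zero_left key
  rw [Complex.exp_neg, inv_mul_eq_iff_eq_mul₀ (Complex.exp_ne_zero _)] at hz
  rw [hz]
  ring

/-! ### The sign modulo 2 and the action of SL₂(ℤ) -/

open Complex in
theorem neg_one_zpow_eq_cexp (n : ℤ) : (-1 : ℂ) ^ n = cexp (Real.pi * I * n) := by
  rw [mul_comm, Complex.exp_int_mul, Complex.exp_pi_mul_I]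

theorem neg_one_zpow_congr {m n : ℤ} (h : m ≡ n [ZMOD 2]) : (-1 : ℂ) ^ m = (-1) ^ n := by
  obtain ⟨k, hk⟩ := h.dvd
  rw [show n = m + 2 * k by linarith, zpow_add₀ (by norm_num), zpow_mul]
  simp

theorem int_modEq_two_iff_zmod {m n : ℤ} : m ≡ n [ZMOD 2] ↔ (m : ZMod 2) = n :=
  (ZMod.intCast_eq_intCast_iff m n 2).symm

/-- The multiplier of `sqrtPhiDelta`: the sign of the permutation by which the matrix
`(a, b; c, d)` acts on the nonzero vectors of the plane over the field with two elements. -/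
noncomputable def modTwoSign (a b c d : ℤ) : ℂ := (-1) ^ ((b + c) * d + (a + 1) * (d + 1))

theorem modTwoSign_translate {a b c d : ℤ} (h : a * d - b * c = 1) :
    modTwoSign (a + c) (b + d) c d = -modTwoSign a b c d := by
  unfold modTwoSign
  have : -(-1 : ℂ) ^ ((b + c) * d + (a + 1) * (d + 1)) =
      (-1) ^ ((b + c) * d + (a + 1) * (d + 1) + 1) := by
    rw [zpow_add_one₀ (by norm_num)]; ring
  rw [this]
  apply neg_one_zpow_congr
  rw [int_modEq_two_iff_zmod]
  have h' := congrArg (Int.cast : ℤ → ZMod 2) h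
  push_cast at h' ⊢
  -- Only the residues matter, so a finite check over `ZMod 2` remains.
  generalize (a : ZMod 2) = a at *
  generalize (b : ZMod 2) = b at *
  generalize (c : ZMod 2) = c at *
  generalize (d : ZMod 2) = d at *
  revert a b c d
  decide

theorem modTwoSign_invert {a b c d : ℤ} (h : a * d - b * c = 1) :
    modTwoSign (-c) (-d) a b = -modTwoSign a b c d := by
  unfold modTwoSign
  have : -(-1 : ℂ) ^ ((b + c) * d + (a + 1) * (d + 1)) =
      (-1) ^ ((b + c) * d + (a + 1) * (d + 1) + 1) := by
    rw [zpow_add_one₀ (by norm_num)]; ring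
  rw [this]
  apply neg_one_zpow_congr
  rw [int_modEq_two_iff_zmod]
  have h' := congrArg (Int.cast : ℤ → ZMod 2) h
  push_cast at h' ⊢
  generalize (a : ZMod 2) = a at *
  generalize (b : ZMod 2) = b at *
  generalize (c : ZMod 2) = c at *
  generalize (d : ZMod 2) = d at *
  revert a b c d
  decide

/-- The multiplier property of `modTwoSign` at the matrix `(a, b; c, d)`. -/
def HasModTwoMultiplier (a b c d : ℤ) : Prop := TransformsWithSign a b c d (modTwoSign a b c d)

theorem intCast_mul_add_ne_zero {c d : ℤ} (h : c ≠ 0 ∨ d ≠ 0) (τ : UpperHalfPlane) :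
    (c : ℂ) * τ + d ≠ 0 := by
  intro h0
  have him := congrArg Complex.im h0
  simp [τ.im_pos.ne'] at him
  subst him
  simp at h0
  simp_all

theorem moebius_im_pos {a b c d : ℤ} (h : a * d - b * c = 1) (τ : UpperHalfPlane) :
    0 < (((a : ℂ) * τ + b) / ((c : ℂ) * τ + d)).im := by
  let g : Matrix.SpecialLinearGroup (Fin 2) ℤ :=
    ⟨!![a, b; c, d], by rw [Matrix.det_fin_two_of, h]⟩
  have := (g • τ).im_pos
  rw [← UpperHalfPlane.coe_im, UpperHalfPlane.coe_specialLinearGroup_apply] at this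
  simpa [g] using this

theorem ne_zero_or_ne_zero_of_det {a b c d : ℤ} (h : a * d - b * c = 1) :
    (c ≠ 0 ∨ d ≠ 0) ∧ (a ≠ 0 ∨ b ≠ 0) := by
  constructor <;> (by_contra! h0; obtain ⟨rfl, rfl⟩ := h0; simp at h)

theorem HasModTwoMultiplier.translate {a b c d : ℤ} (h : a * d - b * c = 1) :
    HasModTwoMultiplier (a + c) (b + d) c d ↔ HasModTwoMultiplier a b c d := by
  unfold HasModTwoMultiplier TransformsWithSign
  refine forall_congr' fun τ ↦ forall_congr' fun z ↦ ?_
  have hj := intCast_mul_add_ne_zero (ne_zero_or_ne_zero_of_det h).1 τ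
  have e : (((a + c : ℤ) : ℂ) * τ + ((b + d : ℤ) : ℂ)) / ((c : ℂ) * τ + d) =
      ((a : ℂ) * τ + b) / ((c : ℂ) * τ + d) + 1 := by
    push_cast
    field_simp
    ring
  rw [e, sqrtPhiDelta_add_one_left, modTwoSign_translate h]
  simp only [neg_mul, neg_inj]

theorem HasModTwoMultiplier.invert {a b c d : ℤ} (h : a * d - b * c = 1)
    (H : HasModTwoMultiplier a b c d) : HasModTwoMultiplier (-c) (-d) a b := by
  intro τ z
  have hj := intCast_mul_add_ne_zero (ne_zero_or_ne_zero_of_det h).1 τ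
  have hn := intCast_mul_add_ne_zero (ne_zero_or_ne_zero_of_det h).2 τ
  have hS := sqrtPhiDelta_neg_one_div (moebius_im_pos h τ) (z / ((c : ℂ) * τ + d))
  have h' : (a : ℂ) * d - b * c = 1 := by exact_mod_cast h
  have hjn : (a : ℂ) * ((c : ℂ) * τ + d) - c * ((a : ℂ) * τ + b) = 1 := by linear_combination h'
  have e0 : ((-c : ℤ) : ℂ) * τ + ((-d : ℤ) : ℂ) = -((c : ℂ) * τ + d) := by push_cast; ring
  rw [H τ z] at hS
  rw [e0, modTwoSign_invert h]
  generalize (c : ℂ) * τ + d = j at *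
  generalize (a : ℂ) * τ + b = n at *
  have e1 : -1 / (n / j) = -j / n := by field_simp
  have e2 : z / j / (n / j) = z / n := by field_simp
  -- The cocycle relation of the exponential factor, which rests on `a j - c n = 1`.
  have e3 : Real.pi * Complex.I * a * z ^ 2 / n =
      Real.pi * Complex.I * (z / j) ^ 2 / (n / j) + Real.pi * Complex.I * c * z ^ 2 / j := by
    field_simp
    linear_combination z ^ 2 * hjn
  rw [e1, e2] at hS
  rw [hS, e3, Complex.exp_add]
  field_simp

theorem HasModTwoMultiplier.neg {a b c d : ℤ} (h : a * d - b * c = 1)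
    (H : HasModTwoMultiplier a b c d) : HasModTwoMultiplier (-a) (-b) (-c) (-d) := by
  have := (H.invert h).invert (by linarith)
  exact this

open Matrix.SpecialLinearGroup ModularGroup in
theorem hasModTwoMultiplier_of_det {a b c d : ℤ} (h : a * d - b * c = 1) :
    HasModTwoMultiplier a b c d := by
  have key : ∀ g : Matrix.SpecialLinearGroup (Fin 2) ℤ,
      HasModTwoMultiplier (g 0 0) (g 0 1) (g 1 0) (g 1 1) := by
    intro g
    have hg : g ∈ Subgroup.closure {S, T} := by simp [SpecialLinearGroup.SL2Z_generators]
    induction hg using Subgroup.closure_induction_left with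
    | one =>
      intro τ z
      simp [modTwoSign, Even.neg_one_pow (show Even 4 by decide)]
    | mul_left x hx y hy ih =>
      have hdet := y.det_coe
      rw [Matrix.det_fin_two] at hdet
      rcases hx with rfl | rfl
      · simpa [coe_mul, coe_S, Matrix.mul_apply, Fin.sum_univ_two] using ih.invert hdet
      · simpa [coe_mul, coe_T, Matrix.mul_apply, Fin.sum_univ_two] using
          (HasModTwoMultiplier.translate hdet).2 ih
    | inv_mul_cancel x hx y hy ih =>
      have hdet := y.det_coe
      rw [Matrix.det_fin_two] at hdet
      rcases hx with rfl | rfl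
      -- Here `S⁻¹ = -S`.
      · have := (ih.invert hdet).neg (by linarith)
        simpa [coe_mul, coe_inv, coe_S, Matrix.mul_apply, Fin.sum_univ_two,
          Matrix.adjugate_fin_two] using this
      · have := (HasModTwoMultiplier.translate (a := y 0 0 - y 1 0) (b := y 0 1 - y 1 1)
          (c := y 1 0) (d := y 1 1) (by linarith)).1 (by simpa using ih)
        simpa [coe_mul, coe_T_inv, Matrix.mul_apply, Fin.sum_univ_two, sub_eq_add_neg] using this
  simpa using key ⟨!![a, b; c, d], by rw [Matrix.det_fin_two_of, h]⟩

/-! ### Dedekind sums: integrality and parity -/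

theorem two_mul_sum_Ico_one {c : ℤ} (hc : 0 < c) :
    2 * ∑ r ∈ Finset.Ico 1 c, r = c * (c - 1) := by
  induction c, (show 1 ≤ c from hc) using Int.leInduction with
  | base => simp
  | succ n hn ih =>
    rw [← Finset.insert_Ico_right_eq_Ico_add_one hn, Finset.sum_insert (by simp), mul_add,
      ih (by lia)]
    ring

theorem six_mul_sum_sq_Ico_one {c : ℤ} (hc : 0 < c) :
    6 * ∑ r ∈ Finset.Ico 1 c, r ^ 2 = c * (c - 1) * (2 * c - 1) := by
  induction c, (show 1 ≤ c from hc) using Int.leInduction with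
  | base => simp
  | succ n hn ih =>
    rw [← Finset.insert_Ico_right_eq_Ico_add_one hn, Finset.sum_insert (by simp), mul_add,
      ih (by lia)]
    ring

/-- Multiplication by `h` permutes the nonzero residues modulo `c`. -/
theorem sum_emod_sq_Ico_one {h c : ℤ} (hc : 0 < c) (hcop : IsCoprime h c) :
    ∑ r ∈ Finset.Ico 1 c, (h * r % c) ^ 2 = ∑ r ∈ Finset.Ico 1 c, r ^ 2 := by
  have hmaps : ∀ r ∈ Finset.Ico 1 c, h * r % c ∈ Finset.Ico 1 c := by
    intro r hr
    rw [Finset.mem_Ico] at hr ⊢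
    refine ⟨?_, Int.emod_lt_of_pos _ hc⟩
    have h0 : h * r % c ≠ 0 := fun h0 ↦ by
      have := Int.le_of_dvd (by lia) (hcop.symm.dvd_of_dvd_mul_left (Int.dvd_of_emod_eq_zero h0))
      lia
    have := Int.emod_nonneg (h * r) hc.ne'
    lia
  have hinj : Set.InjOn (fun r ↦ h * r % c) (Finset.Ico 1 c : Set ℤ) := by
    intro r hr s hs hrs
    simp only [Finset.coe_Ico, Set.mem_Ico] at hr hs
    have hd : c ∣ h * (r - s) := by
      rw [mul_sub]
      exact Int.ModEq.dvd (Int.ModEq.symm hrs)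
    exact sub_eq_zero.mp (Int.eq_zero_of_abs_lt_dvd (hcop.symm.dvd_of_dvd_mul_left hd)
      (by rw [abs_lt]; lia))
  have himg : (Finset.Ico 1 c).image (fun r ↦ h * r % c) = Finset.Ico 1 c :=
    Finset.eq_of_subset_of_card_le (Finset.image_subset_iff.mpr hmaps)
      (Finset.card_image_of_injOn hinj).ge
  conv_rhs => rw [← himg, Finset.sum_image hinj]

/-- Expand the squares of `h r % c = h r - c (h r / c)` in the permutation identity and cancel one
factor `c`. -/
theorem twelve_mul_sum_mul_ediv {h c : ℤ} (hc : 0 < c) (hcop : IsCoprime h c) :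
    12 * h * ∑ r ∈ Finset.Ico 1 c, r * (h * r / c) =
      (h ^ 2 - 1) * (c - 1) * (2 * c - 1) + 6 * c * ∑ r ∈ Finset.Ico 1 c, (h * r / c) ^ 2 := by
  have h1 := sum_emod_sq_Ico_one hc hcop
  have h2 : ∑ r ∈ Finset.Ico 1 c, (h * r % c) ^ 2 = h ^ 2 * ∑ r ∈ Finset.Ico 1 c, r ^ 2 -
      2 * h * c * ∑ r ∈ Finset.Ico 1 c, r * (h * r / c) +
      c ^ 2 * ∑ r ∈ Finset.Ico 1 c, (h * r / c) ^ 2 := by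
    rw [Finset.mul_sum, Finset.mul_sum, Finset.mul_sum, ← Finset.sum_sub_distrib,
      ← Finset.sum_add_distrib]
    refine Finset.sum_congr rfl fun r _ ↦ ?_
    rw [Int.emod_def]
    ring
  have h3 := six_mul_sum_sq_Ico_one hc
  apply mul_left_cancel₀ hc.ne'
  linear_combination 6 * h2 - 6 * h1 + (h ^ 2 - 1) * h3

theorem floor_intCast_mul_div (h r : ℤ) {c : ℤ} (hc : 0 < c) :
    ⌊(h : ℝ) * r / c⌋ = h * r / c := by
  have hc' : (0 : ℝ) < c := by exact_mod_cast hc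
  rw [Int.floor_eq_iff, le_div_iff₀ hc', div_lt_iff₀ hc']
  constructor
  · exact_mod_cast Int.ediv_mul_le _ hc.ne'
  · exact_mod_cast Int.lt_ediv_add_one_mul_self _ hc

theorem mul_twelve_dedekindSum (h : ℤ) {c : ℤ} (hc : 0 < c) :
    (c : ℝ) * (12 * dedekindSum h c) =
      ((2 * h * (c - 1) * (2 * c - 1) - 12 * ∑ r ∈ Finset.Ico 1 c, r * (h * r / c) -
        3 * c * (c - 1) : ℤ) : ℝ) := by
  have hc' : (c : ℝ) ≠ 0 := by exact_mod_cast hc.ne'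
  have e : (c : ℝ) * (c * (12 * dedekindSum h c)) =
      12 * h * ((∑ r ∈ Finset.Ico 1 c, r ^ 2 : ℤ) : ℝ) -
      12 * c * ((∑ r ∈ Finset.Ico 1 c, r * (h * r / c) : ℤ) : ℝ) -
      6 * c * ((∑ r ∈ Finset.Ico 1 c, r : ℤ) : ℝ) := by
    unfold dedekindSum
    simp only [Int.cast_sum]
    simp only [Finset.mul_sum, ← Finset.sum_sub_distrib]
    refine Finset.sum_congr rfl fun r _ ↦ ?_
    rw [floor_intCast_mul_div h r hc]
    push_cast
    field_simp
    ring
  have h1 : (2 : ℝ) * ((∑ r ∈ Finset.Ico 1 c, r : ℤ) : ℝ) = c * (c - 1) := by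
    exact_mod_cast two_mul_sum_Ico_one hc
  have h2 : (6 : ℝ) * ((∑ r ∈ Finset.Ico 1 c, r ^ 2 : ℤ) : ℝ) = c * (c - 1) * (2 * c - 1) := by
    exact_mod_cast six_mul_sum_sq_Ico_one hc
  apply mul_left_cancel₀ hc'
  rw [e, Int.cast_sub, Int.cast_sub, Int.cast_mul 12]
  push_cast [-Int.cast_sum]
  linear_combination 2 * h * h2 - 3 * c * h1

/-- The Rademacher function `(a + d) / c + 12 s(-d, c)` takes integer values, whose parity is
determined by the matrix modulo `2`. -/
theorem exists_int_eq_rademacher {a b c d : ℤ} (hdet : a * d - b * c = 1) (hc : 0 < c) :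
    ∃ n : ℤ, ((a : ℝ) + d) / c + 12 * dedekindSum (-d) c = n ∧
      n + 1 ≡ (b + c) * d + (a + 1) * (d + 1) [ZMOD 2] := by
  have hcop : IsCoprime (-d) c := ⟨-a, -b, by linarith⟩
  have h1 := twelve_mul_sum_mul_ediv hc hcop
  have h2 := mul_twelve_dedekindSum (-d) hc
  generalize (∑ r ∈ Finset.Ico 1 c, r * (-d * r / c)) = N at h1 h2
  generalize (∑ r ∈ Finset.Ico 1 c, (-d * r / c) ^ 2) = M at h1
  set X : ℤ := a + d + (2 * -d * (c - 1) * (2 * c - 1) - 12 * N - 3 * c * (c - 1)) with hX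
  -- The floor sum `N` is controlled only after multiplication by `h = -d`; coprimality then removes
  -- `-d` again.
  have hdX : -d * X =
      c * (-b + (d ^ 2 + 1) * (2 * c - 3) - 6 * M + 3 * d * (c - 1)) := by
    rw [hX]
    linear_combination -h1 - hdet
  obtain ⟨n, hn⟩ : c ∣ X := hcop.symm.dvd_of_dvd_mul_left ⟨_, hdX⟩
  refine ⟨n, ?_, ?_⟩
  · have hc' : (c : ℝ) ≠ 0 := by exact_mod_cast hc.ne'
    apply mul_left_cancel₀ hc'
    rw [mul_add, h2, mul_div_cancel₀ _ hc']
    exact_mod_cast hn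
  -- The values of `d n` and `c n` modulo 2 determine `n` modulo 2, since `c` and `d` are not both
  -- even.
  · have hdn : -d * n = -b + (d ^ 2 + 1) * (2 * c - 3) - 6 * M + 3 * d * (c - 1) := by
      apply mul_left_cancel₀ hc.ne'
      rw [← hdX, hn]
      ring
    rw [hX] at hn
    rw [int_modEq_two_iff_zmod]
    have h2' : ∀ x : ZMod 2, 2 * x = 0 := by decide
    have k1 : (-d * n : ZMod 2) = -b + (d ^ 2 + 1) + d * (c - 1) := by
      have := congrArg (Int.cast : ℤ → ZMod 2) hdn
      push_cast at this
      linear_combination this + h2' ((d ^ 2 + 1) * (c - 2) - 3 * M + d * (c - 1))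
    have k2 : (a + d + c * (c - 1) : ZMod 2) = c * n := by
      have := congrArg (Int.cast : ℤ → ZMod 2) hn
      push_cast at this
      linear_combination this + h2' (d * (c - 1) * (2 * c - 1) + 6 * N + 2 * c * (c - 1))
    have k3 := congrArg (Int.cast : ℤ → ZMod 2) hdet
    push_cast at k3 ⊢
    clear_value X
    generalize (a : ZMod 2) = a at *
    generalize (b : ZMod 2) = b at *
    generalize (c : ZMod 2) = c at *
    generalize (d : ZMod 2) = d at *
    generalize (n : ZMod 2) = n at *
    clear h2'
    revert a b c d n
    decide

theorem modTwoSign_eq_neg_cexp {a b c d : ℤ} (hdet : a * d - b * c = 1) (hc : 0 < c) :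
    modTwoSign a b c d = -Complex.exp (Real.pi * Complex.I *
      (((a : ℂ) + d) / c + 12 * (dedekindSum (-d) c : ℂ))) := by
  obtain ⟨n, hn, hpar⟩ := exists_int_eq_rademacher hdet hc
  have hn' : ((a : ℂ) + d) / c + 12 * (dedekindSum (-d) c : ℂ) = n := by exact_mod_cast hn
  rw [hn', ← neg_one_zpow_eq_cexp, modTwoSign, ← neg_one_zpow_congr hpar,
    zpow_add_one₀ (by norm_num)]
  ring

/-! ### Uniqueness of the multiplier and conclusion -/

theorem modTwoSign_sq (a b c d : ℤ) : modTwoSign a b c d ^ 2 = 1 := by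
  rw [modTwoSign, ← zpow_natCast, ← zpow_mul, mul_comm, zpow_mul]
  simp

theorem sqrtPhiDelta_I_half_ne_zero : sqrtPhiDelta Complex.I (1 / 2) ≠ 0 := by
  intro h
  obtain ⟨m, n, hmn⟩ := sqrtPhiDelta_eq_zero (by simp) h
  have hre := congrArg Complex.re hmn
  simp at hre
  have : (1 : ℝ) = (2 * m : ℤ) := by push_cast; linarith
  have : (1 : ℤ) = 2 * m := by exact_mod_cast this
  lia

/-- At `(i, 1/2)` no factor vanishes, because `1/2` is not in `ℤ + ℤ i`. -/
theorem TransformsWithSign.unique {a b c d : ℤ} (hdet : a * d - b * c = 1) {e e' : ℂ}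
    (h : TransformsWithSign a b c d e) (h' : TransformsWithSign a b c d e') : e = e' := by
  have hj := intCast_mul_add_ne_zero (ne_zero_or_ne_zero_of_det hdet).1 UpperHalfPlane.I
  have key := (h UpperHalfPlane.I (1 / 2)).symm.trans (h' UpperHalfPlane.I (1 / 2))
  have hF : sqrtPhiDelta (UpperHalfPlane.I : ℂ) (1 / 2) ≠ 0 := sqrtPhiDelta_I_half_ne_zero
  exact mul_right_cancel₀ (pow_ne_zero 5 hj)
    (mul_right_cancel₀ (Complex.exp_ne_zero _) (mul_right_cancel₀ hF key))

theorem mainTheorem7 (a b c d : ℤ) (hdet : a * d - b * c = 1) (hc : 0 < c) :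
    (∀ e : ℂ, TransformsWithSign a b c d e ↔
      e = -Complex.exp (Real.pi * Complex.I *
        (((a : ℂ) + d) / c + 12 * (dedekindSum (-d) c : ℂ)))) ∧
    (∀ e : ℂ, TransformsWithSign a b c d e → e ^ 2 = 1) := by
  have H : TransformsWithSign a b c d (modTwoSign a b c d) := hasModTwoMultiplier_of_det hdet
  rw [← modTwoSign_eq_neg_cexp hdet hc]
  refine ⟨fun e ↦ ⟨fun h ↦ h.unique hdet H, fun h ↦ h ▸ H⟩, fun e h ↦ ?_⟩
  rw [h.unique hdet H, modTwoSign_sq]
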